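/- All graphs are finite and simple. For a connected graph $G$ on $n$ vertices, let $\lambda_1(D(G))$ be the largest eigenvalue of its distance matrix $D(G)=(d_G(u,v))_{u,v\in V(G)}$. Let $c(G-S)$ be the number of connected components of the graph obtained from $G$ by deleting the vertex set $S$, and let $$\tau(G)=\min\Big\{\frac{|S|}{c(G-S)-1} : S\subset V(G),\ c(G-S)>1\Big\}$$ (with $\tau(G)=\infty$ if $G$ is complete) be Enomoto's variation of toughness; $G$ is called $1$-tough (in Enomoto's sense) if $\tau(G)\ge 1$. Let $\vee$ denote the join and $\cup$ the disjoint union of graphs. Theorem. Let $G$ be a connected graph of order $n\ge\max\{9\delta,\ \tfrac{\delta^2}{2}+3\delta+3\}$ with minimum degree $\delta\ge 2$, and let $G^*=K_\delta\vee(K_{n-2\delta-1}\cup(\delta+1)K_1)$. If $\lambda_1(D(G))\le\lambda_1(D(G^*))$, then $G$ is $1$-tough in Enomoto's sense, unless $G\cong G^*$. The exception is genuine: if $G\cong G^*$, then $G$ is not $1$-tough. -/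

import Mathlib

open scoped ENNReal

noncomputable section

namespace SimpleGraph

/-- The join `G ∨ H` of two vertex-disjoint graphs: their disjoint union together with all
edges between the two vertex sets. -/
def joinGraph {V W : Type*} (G : SimpleGraph V) (H : SimpleGraph W) : SimpleGraph (V ⊕ W) :=
  (G ⊕g H) ⊔ completeBipartiteGraph V W

/-- The number `c(G - S)` of connected components of the graph obtained from `G` by deleting
the vertices in `S`. -/
def componentsAfterDeleting {V : Type*} (G : SimpleGraph V) (S : Set V) : ℕ :=
  Nat.card (G.induce Sᶜ).ConnectedComponent

/-- Enomoto's variation of toughness: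
`τ(G) = min { |S| / (c(G - S) - 1) : S ⊆ V(G), c(G - S) > 1 }`. It takes values in `[0, ∞]`,
with value `∞` if no vertex set `S` satisfies `c(G - S) > 1`, i.e. if `G` is complete. -/
def enomotoToughness {V : Type*} [Fintype V] (G : SimpleGraph V) : ℝ≥0∞ :=
  ⨅ (S : Finset V) (_ : 1 < G.componentsAfterDeleting (S : Set V)),
    (S.card : ℝ≥0∞) / ((G.componentsAfterDeleting (S : Set V) - 1 : ℕ) : ℝ≥0∞)

/-- `G` is `t`-tough in Enomoto's sense if `τ(G) ≥ t`. -/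
def IsEnomotoTough {V : Type*} [Fintype V] (G : SimpleGraph V) (t : ℝ≥0∞) : Prop :=
  t ≤ G.enomotoToughness

/-- The distance matrix `D(G)`, whose `(i, j)`-entry is the distance from `i` to `j`. -/
def distMatrix {V : Type*} (G : SimpleGraph V) : Matrix V V ℝ :=
  Matrix.of fun i j => (G.dist i j : ℝ)

/-- The distance matrix is real symmetric. -/
theorem distMatrix_isHermitian {V : Type*} (G : SimpleGraph V) : G.distMatrix.IsHermitian := by
  ext i j
  simp [distMatrix, SimpleGraph.dist_comm]

/-- The distance spectral radius `λ₁(D(G))`: the largest eigenvalue of the distance matrix. -/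
def distSpectralRadius {V : Type*} [Fintype V] [DecidableEq V] (G : SimpleGraph V) : ℝ :=
  ⨆ i, G.distMatrix_isHermitian.eigenvalues i

/-- The graph `K_δ ∨ (K_{n-2δ-1} ∪ (δ+1)K₁)`, a graph of order `n` if `2δ + 1 ≤ n`. -/
abbrev extremalGraph (n δ : ℕ) :
    SimpleGraph (Fin δ ⊕ (Fin (n - 2 * δ - 1) ⊕ Fin (δ + 1))) :=
  joinGraph (⊤ : SimpleGraph (Fin δ))
    ((⊤ : SimpleGraph (Fin (n - 2 * δ - 1))) ⊕g (⊥ : SimpleGraph (Fin (δ + 1))))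

end SimpleGraph

end

/-! If `G` is not 1-tough, some set `S` of `s` vertices leaves at least `s + 2` components; group
them into `s + 2` classes. Vertices in different classes are at distance at least 2, so `D(G)`
dominates entrywise the distance matrix of a model graph in which `S` is joined to everything and
each class is a clique. A Rayleigh quotient with a positive three-valued vector then bounds the
spectral radius of `G` from below.

The vector is modelled on the Perron vector of `K_s ∨ (K_q ∪ (s+1)K_t)`, where every class has at
least `t` vertices. For a real `M` it is built so that on that graph `(D + I)x - Mx` is a constant
vector, of value `joinResidual`. Choosing `M` as a root of the cubic that makes this residual vanish
for `G*` gives `λ₁(D(G*)) ≤ M - 1` (`distSpectralRadius_extremalGraph_le`), whereas `λ₁(D(G)) ≤ M -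
1` forces the residual of `G` to be nonpositive (`joinResidual_bound`).

If `s < δ`, the minimum degree allows `t = δ + 1 - s` and the residual is positive
(`joinResidual_pos_of_lt`). If `s > δ`, it is positive already for `t = 1`
(`joinResidual_pos_of_gt`). For `s = δ` it is zero, all estimates are tight, and `G` is recovered as
`G*`. -/

/-! ### Polynomial inequalities for the residual -/

theorem exists_extremal_root (n d : ℝ) (hd : 2 ≤ d) (hn : 9 * d ≤ n) :
    ∃ M : ℝ, n + 3 * d / 2 + 2 ≤ M ∧
      (M + d + 1 - n) * (M + 1) * M = (d + 1) * (M + n - 1 - 2 * d) * (2 * M - d) := by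
  let P : ℝ → ℝ := fun M => (M + d + 1 - n) * (M + 1) * M -
    (d + 1) * (M + n - 1 - 2 * d) * (2 * M - d)
  have hc : ContinuousOn P (Set.Icc (n + 3 * d / 2 + 2) (n + 3 * d + 3)) := by
    apply Continuous.continuousOn
    fun_prop
  -- The left endpoint is the lower bound on `M` that `joinResidual_pos_of_gt` needs. Measured from
  -- the corner `d = 2`, `n = 9d`, all coefficients have one sign.
  have h0 : P (n + 3 * d / 2 + 2) ≤ 0 := by
    obtain ⟨v, rfl⟩ : ∃ v, n = 9 * d + v := ⟨n - 9 * d, by ring⟩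
    obtain ⟨w, rfl⟩ : ∃ w, d = 2 + w := ⟨d - 2, by ring⟩
    have hv : 0 ≤ v := by linarith
    have hw : 0 ≤ w := by linarith
    rw [← neg_nonneg]
    simp only [P]
    ring_nf
    positivity
  have h1 : 0 ≤ P (n + 3 * d + 3) := by
    obtain ⟨v, rfl⟩ : ∃ v, n = 9 * d + v := ⟨n - 9 * d, by ring⟩
    obtain ⟨w, rfl⟩ : ∃ w, d = 2 + w := ⟨d - 2, by ring⟩
    have hv : 0 ≤ v := by linarith
    have hw : 0 ≤ w := by linarith
    simp only [P]
    ring_nf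
    positivity
  obtain ⟨M, hM, hPM⟩ := intermediate_value_Icc (by linarith) hc ⟨h0, h1⟩
  exact ⟨M, hM.1, sub_eq_zero.mp hPM⟩

/-- The amount by which the three-valued test vector of a graph `K_s ∨ (K_q ∪ (k/t) K_t)` on
`n` vertices overshoots the eigenvalue equation for the value `M - 1`. -/
noncomputable def joinResidual (n M s t k : ℝ) : ℝ :=
  (n - k - M) * (M + t) * M + k * (M + n - s - k) * (2 * M - s)

theorem joinResidual_eq_zero {n d M : ℝ}
    (hP : (M + d + 1 - n) * (M + 1) * M = (d + 1) * (M + n - 1 - 2 * d) * (2 * M - d)) :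
    joinResidual n M d 1 (d + 1) = 0 := by
  unfold joinResidual
  linear_combination -hP

/-- The residual vanishes at `t = 1`, `s = d`, so eliminating the cubic with `hP` leaves a factor `t
- 1`. Since `B ≥ nM`, the cofactor is at least `(s-1)(M+1)M(n - 2(s+1)t)` plus a strictly positive
term, which alone decides the case `s = 1`. -/
theorem joinResidual_pos_of_lt {n d M s t : ℝ} (hs : 1 ≤ s) (ht : 2 ≤ t) (hd : d = s + t - 1)
    (hn : 9 * d ≤ n) (hk : 2 * ((s + 1) * t) ≤ n) (hM : n + 1 ≤ M)
    (hP : (M + d + 1 - n) * (M + 1) * M = (d + 1) * (M + n - 1 - 2 * d) * (2 * M - d)) :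
    0 < joinResidual n M s t ((s + 1) * t) := by
  set B := (M + n - 1 - 2 * d) * (2 * M - d) - (M + 1) * M with hB
  have hd2 : 2 ≤ d := by linarith
  have hM0 : 0 < M := by linarith
  have hBn : n * M ≤ B := by
    have : 0 ≤ B - n * M := by
      have e : B - n * M = (M - 3) * M + (n - 9 * d) * M + 3 * d * M + d * (M - n + 1) +
          2 * d * d := by
        rw [hB]; ring
      have h1 : 0 ≤ (M - 3) * M := mul_nonneg (by linarith) hM0.le
      have h2 : 0 ≤ (n - 9 * d) * M := mul_nonneg (by linarith) hM0.le
      have h3 : 0 ≤ d * (M - n + 1) := mul_nonneg (by linarith) (by linarith)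
      rw [e]; positivity
    linarith
  have hfac : (M + 1) * joinResidual n M s t ((s + 1) * t) = (t - 1) *
      ((s * M - t) * B - (s + 1) * t * (M + 1) *
        (2 * (s - 1) * M - (n - 2 * d - 1 - s + s ^ 2))) := by
    subst hd
    rw [hB]; unfold joinResidual
    linear_combination (-(M + t)) * hP
  have hsM : (s - 1) * (M + 1) ≤ s * M - t := by nlinarith
  have hs1 : 0 ≤ (s - 1) * (M + 1) := mul_nonneg (by linarith) (by linarith)
  have h1 : (s - 1) * (M + 1) * (n * M) ≤ (s * M - t) * B :=
    mul_le_mul hsM hBn (mul_nonneg (by linarith) hM0.le) (hs1.trans hsM)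
  have h2 : 0 ≤ (n - 2 * ((s + 1) * t)) * ((s - 1) * (M + 1) * M) :=
    mul_nonneg (by linarith) (mul_nonneg hs1 hM0.le)
  have h3 : 0 < (s + 1) * t * (M + 1) * (n - 2 * d - 1 - s + s ^ 2) := by
    have : 0 < n - 2 * d - 1 - s + s ^ 2 := by nlinarith
    positivity
  have h4 : 0 < (M + 1) * joinResidual n M s t ((s + 1) * t) := by
    rw [hfac]
    apply mul_pos (by linarith)
    nlinarith
  exact pos_of_mul_pos_right h4 (by linarith)

/-- Subtracting the vanishing residual at `s = d` leaves a factor `s - d`. The cofactor is a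
polynomial with nonnegative coefficients in the slacks of the four hypotheses on `M`, `s`, `n` and
`d`. -/
theorem joinResidual_pos_of_gt {n d M s : ℝ} (hd : 2 ≤ d) (hs : d < s) (hsn : 2 * s + 2 ≤ n)
    (hn : 9 * d ≤ n) (hM : n + 3 * d / 2 + 2 ≤ M)
    (hP : (M + d + 1 - n) * (M + 1) * M = (d + 1) * (M + n - 1 - 2 * d) * (2 * M - d)) :
    0 < joinResidual n M s 1 (s + 1) := by
  have h : 0 < M * (M + 2 * n - 3) - (5 * M + n - 1) * (1 + s + d) + 2 * (s + d) +
      2 * (s ^ 2 + s * d + d ^ 2) := by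
    obtain ⟨r, rfl⟩ : ∃ r, M = n + 3 * d / 2 + 2 + r := ⟨M - (n + 3 * d / 2 + 2), by ring⟩
    obtain ⟨u, rfl⟩ : ∃ u, s = n / 2 - 1 - u := ⟨n / 2 - 1 - s, by ring⟩
    obtain ⟨v, rfl⟩ : ∃ v, n = 9 * d + v := ⟨n - 9 * d, by ring⟩
    obtain ⟨w, rfl⟩ : ∃ w, d = 2 + w := ⟨d - 2, by ring⟩
    have hv : 0 ≤ v := by linarith
    have hw : 0 ≤ w := by linarith
    have hu : 0 ≤ u := by linarith
    have hr : 0 ≤ r := by linarith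
    ring_nf
    positivity
  have hfac : joinResidual n M s 1 (s + 1) = (s - d) * (M * (M + 2 * n - 3) -
      (5 * M + n - 1) * (1 + s + d) + 2 * (s + d) + 2 * (s ^ 2 + s * d + d ^ 2)) := by
    unfold joinResidual
    linear_combination -hP
  rw [hfac]
  exact mul_pos (by linarith) h

/-- The first weight of the test vector is positive. -/
theorem joinWeight_pos {n M s t k : ℝ} (hs : 0 ≤ s) (ht : 0 ≤ t) (hk0 : 0 ≤ k) (hk : 2 * k ≤ n)
    (hM : n + 1 ≤ M) : 0 < M * (M + t) - k * (M + (n - s - k)) := by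
  have h1 : k * (M + (n - s - k)) ≤ k * (M + (n - k)) :=
    mul_le_mul_of_nonneg_left (by linarith) hk0
  nlinarith [mul_nonneg ht (by linarith : 0 ≤ M), mul_nonneg hk0 hk0,
    mul_nonneg (by linarith : 0 ≤ n - 2 * k) (by linarith : 0 ≤ M)]

/-! ### Spectral bounds for symmetric matrices -/

namespace Matrix.IsHermitian

variable {m : Type*} [Fintype m] [DecidableEq m] {A : Matrix m m ℝ}

/-- Parseval in an orthonormal eigenbasis turns both sides into sums of squared coefficients,
compared term by term. -/
theorem dotProduct_mulVec_le_iSup_eigenvalues (hA : A.IsHermitian) (x : m → ℝ) :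
    x ⬝ᵥ A *ᵥ x ≤ (⨆ i, hA.eigenvalues i) * (x ⬝ᵥ x) := by
  have hb : ∀ y : m → ℝ, x ⬝ᵥ y = ∑ i, (x ⬝ᵥ ⇑(hA.eigenvectorBasis i)) *
      (⇑(hA.eigenvectorBasis i) ⬝ᵥ y) := by
    intro y
    have h := hA.eigenvectorBasis.sum_inner_mul_inner (WithLp.toLp 2 x) (WithLp.toLp 2 y)
    simp only [EuclideanSpace.inner_eq_star_dotProduct, star_trivial] at h
    rw [dotProduct_comm x y, ← h]
    refine Finset.sum_congr rfl fun i _ => ?_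
    rw [dotProduct_comm x, dotProduct_comm y]
  rw [hb (A *ᵥ x), hb x, Finset.mul_sum]
  refine Finset.sum_le_sum fun i _ => ?_
  have h1 : ⇑(hA.eigenvectorBasis i) ⬝ᵥ A *ᵥ x =
      hA.eigenvalues i * (x ⬝ᵥ ⇑(hA.eigenvectorBasis i)) := by
    have hT : Aᵀ = A := by simpa [Matrix.IsHermitian] using hA
    rw [dotProduct_mulVec, ← mulVec_transpose, hT, hA.mulVec_eigenvectorBasis, smul_dotProduct,
      dotProduct_comm, smul_eq_mul]
  rw [h1, dotProduct_comm _ x]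
  have h2 : hA.eigenvalues i ≤ ⨆ i, hA.eigenvalues i :=
    le_ciSup (Set.finite_range _).bddAbove i
  nlinarith [mul_self_nonneg (x ⬝ᵥ ⇑(hA.eigenvectorBasis i))]

/-- A nonnegative symmetric matrix with a positive subinvariant vector for the value `c` has all
eigenvalues at most `c`. -/
theorem eigenvalues_le_of_mulVec_le (hA : A.IsHermitian) (h0 : ∀ i j, 0 ≤ A i j) {x : m → ℝ}
    (hx : ∀ i, 0 < x i) {c : ℝ} (hc : ∀ i, (A *ᵥ x) i ≤ c * x i) (i : m) :
    hA.eigenvalues i ≤ c := by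
  have key : ∀ y : m → ℝ, y ⬝ᵥ A *ᵥ y ≤ c * (y ⬝ᵥ y) := by
    intro y
    have hsym : ∀ i j, A i j = A j i := fun i j => by
      simpa using (hA.apply i j).symm
    have h1 : y ⬝ᵥ A *ᵥ y ≤ ∑ i, ∑ j, (A i j * (y i ^ 2 * x j / x i) +
        A j i * (y j ^ 2 * x i / x j)) / 2 := by
      simp only [dotProduct, mulVec, Finset.mul_sum]
      refine Finset.sum_le_sum fun i _ => Finset.sum_le_sum fun j _ => ?_
      -- Weighted AM-GM with weights from `x`; after symmetrizing, the sum is `∑ y i ^ 2 * (A x) i /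
      -- x i`, so no Perron-Frobenius theory is needed.
      have h : 2 * (y i * y j) ≤ y i ^ 2 * x j / x i + y j ^ 2 * x i / x j := by
        have hi := hx i
        have hj := hx j
        have e : y i ^ 2 * x j / x i + y j ^ 2 * x i / x j - 2 * (y i * y j) =
            (y i * x j - y j * x i) ^ 2 / (x i * x j) := by
          field_simp
          ring
        have : 0 ≤ (y i * x j - y j * x i) ^ 2 / (x i * x j) := by positivity
        linarith
      rw [← hsym i j]
      nlinarith [mul_le_mul_of_nonneg_left h (h0 i j)]
    have h2 : ∑ i, ∑ j, (A i j * (y i ^ 2 * x j / x i) + A j i * (y j ^ 2 * x i / x j)) / 2 =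
        ∑ i, ∑ j, A i j * (y i ^ 2 * x j / x i) := by
      have h3 : ∑ i, ∑ j, A j i * (y j ^ 2 * x i / x j) =
          ∑ i, ∑ j, A i j * (y i ^ 2 * x j / x i) := Finset.sum_comm
      simp only [← Finset.sum_div, Finset.sum_add_distrib]
      rw [h3]
      ring
    rw [h2] at h1
    refine h1.trans ?_
    simp only [dotProduct]
    rw [Finset.mul_sum]
    refine Finset.sum_le_sum fun i _ => ?_
    have h4 : ∑ j, A i j * (y i ^ 2 * x j / x i) = y i ^ 2 / x i * (A *ᵥ x) i := by
      simp only [mulVec, dotProduct, Finset.mul_sum]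
      refine Finset.sum_congr rfl fun j _ => ?_
      ring
    rw [h4]
    have hi := hx i
    calc y i ^ 2 / x i * (A *ᵥ x) i ≤ y i ^ 2 / x i * (c * x i) :=
          mul_le_mul_of_nonneg_left (hc i) (by positivity)
      _ = c * (y i * y i) := by field_simp
  have h := key ⇑(hA.eigenvectorBasis i)
  rw [hA.mulVec_eigenvectorBasis, dotProduct_smul, smul_eq_mul] at h
  have hone : ⇑(hA.eigenvectorBasis i) ⬝ᵥ ⇑(hA.eigenvectorBasis i) = (1 : ℝ) := by
    have := hA.eigenvectorBasis.orthonormal.1 i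
    have h2 : inner ℝ (hA.eigenvectorBasis i) (hA.eigenvectorBasis i) = (1 : ℝ) := by
      rw [real_inner_self_eq_norm_sq, this]; norm_num
    rw [EuclideanSpace.inner_eq_star_dotProduct] at h2
    exact h2
  rw [hone] at h
  linarith

end Matrix.IsHermitian

/-! ### Components, classes and toughness -/

namespace SimpleGraph

theorem two_le_dist_of_not_adj {V : Type*} {G : SimpleGraph V} (hG : G.Connected) {u v : V}
    (hne : u ≠ v) (h : ¬ G.Adj u v) : 2 ≤ G.dist u v := by
  have h0 : G.dist u v ≠ 0 := fun h0 => hne ((hG u v).dist_eq_zero_iff.mp h0)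
  have h1 : G.dist u v ≠ 1 := fun h1 => h (dist_eq_one_iff_adj.mp h1)
  omega

theorem one_le_dist_of_ne {V : Type*} {G : SimpleGraph V} (hG : G.Connected) {u v : V}
    (hne : u ≠ v) : 1 ≤ G.dist u v :=
  (hG u v).pos_dist_of_ne hne

/-- If the edges outside `S` join vertices with equal `f`-values, then `f` takes at most
`c(G - S)` values outside `S`. -/
theorem card_le_componentsAfterDeleting {V α : Type*} [Finite V] [Fintype α] (G : SimpleGraph V)
    (S : Set V) (f : V → α) (hf : ∀ u v, u ∉ S → v ∉ S → G.Adj u v → f u = f v)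
    (hsurj : ∀ i, ∃ v, v ∉ S ∧ f v = i) :
    Fintype.card α ≤ G.componentsAfterDeleting S := by
  have hc : ∀ (v w : ↥(Sᶜ)) (_ : (G.induce Sᶜ).Walk v w), f v = f w := by
    intro v w p
    induction p with
    | nil => rfl
    | @cons u v _ h _ ih => exact (hf u.1 v.1 u.2 v.2 h).trans ih
  let g : (G.induce Sᶜ).ConnectedComponent → α :=
    ConnectedComponent.lift (fun v : ↥(Sᶜ) => f v) fun v w p _ => hc v w p
  have hg : Function.Surjective g := by
    intro i
    obtain ⟨v, hv, rfl⟩ := hsurj i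
    exact ⟨(G.induce Sᶜ).connectedComponentMk ⟨v, hv⟩, rfl⟩
  rw [componentsAfterDeleting, ← Nat.card_eq_fintype_card]
  exact Nat.card_le_card_of_surjective g hg

/-- If `c(G - S) ≥ r + 1`, then the vertices outside `S` split into `r + 1` nonempty classes with
no edges between different classes. -/
theorem exists_classes_of_le_componentsAfterDeleting {V : Type*} [Finite V] (G : SimpleGraph V)
    (S : Set V) (r : ℕ) (h : r + 1 ≤ G.componentsAfterDeleting S) :
    ∃ f : V → Fin (r + 1), (∀ u v, u ∉ S → v ∉ S → G.Adj u v → f u = f v) ∧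
      ∀ i, ∃ v, v ∉ S ∧ f v = i := by
  classical
  have : Fintype (G.induce Sᶜ).ConnectedComponent := Fintype.ofFinite _
  rw [componentsAfterDeleting, Nat.card_eq_fintype_card] at h
  obtain ⟨e⟩ : Nonempty (Fin (r + 1) ↪ (G.induce Sᶜ).ConnectedComponent) :=
    Function.Embedding.nonempty_of_card_le (by simpa using h)
  -- A left inverse of the embedding of labels: surplus components are merged into an arbitrary
  -- class.
  let g := Function.invFun e
  have hg : Function.Surjective g := Function.invFun_surjective e.injective
  refine ⟨fun v => if hv : v ∈ S then 0 else
    g ((G.induce Sᶜ).connectedComponentMk ⟨v, hv⟩), ?_, ?_⟩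
  · intro u v hu hv huv
    simp only [hu, hv, dite_false]
    congr 1
    exact ConnectedComponent.sound (Adj.reachable (by simpa using huv))
  · intro i
    obtain ⟨c, rfl⟩ := hg i
    induction c using ConnectedComponent.ind with
    | h v => exact ⟨v.1, v.2, by simp only [dif_neg v.2]⟩

theorem not_isEnomotoTough_one_iff {V : Type*} [Fintype V] (G : SimpleGraph V) :
    ¬ G.IsEnomotoTough 1 ↔
      ∃ S : Finset V, S.card + 2 ≤ G.componentsAfterDeleting (S : Set V) := by
  have key : ∀ s c : ℕ, 1 < c → ((s : ℝ≥0∞) / ((c - 1 : ℕ) : ℝ≥0∞) < 1 ↔ s + 2 ≤ c) := by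
    intro s c hc
    have h0 : ((c - 1 : ℕ) : ℝ≥0∞) ≠ 0 := by
      rw [Ne, Nat.cast_eq_zero]; omega
    rw [ENNReal.div_lt_iff (Or.inl h0) (Or.inl (ENNReal.natCast_ne_top _)), one_mul, Nat.cast_lt]
    omega
  rw [IsEnomotoTough, enomotoToughness, not_le]
  simp only [iInf_lt_iff]
  constructor
  · rintro ⟨S, hS, h⟩
    exact ⟨S, (key _ _ hS).mp h⟩
  · rintro ⟨S, h⟩
    exact ⟨S, by omega, (key _ _ (by omega)).mpr h⟩

end SimpleGraph

/-! ### The quadratic form of the test vector -/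

namespace SimpleGraph

open Finset

/-- The distances in the graph in which two distinct vertices are nonadjacent exactly if they lie
outside `S` and have different `f`-values. -/
def classDist {V α : Type*} [DecidableEq V] [DecidableEq α] (S : Finset V) (f : V → α)
    (u v : V) : ℝ :=
  if u = v then 0 else if u ∉ S ∧ v ∉ S ∧ f u ≠ f v then 2 else 1

theorem classDist_le_dist {V α : Type*} [DecidableEq V] [DecidableEq α] {G : SimpleGraph V}
    (hG : G.Connected) {S : Finset V} {f : V → α}
    (hf : ∀ u v, u ∉ S → v ∉ S → G.Adj u v → f u = f v) (u v : V) :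
    classDist S f u v ≤ G.dist u v := by
  unfold classDist
  split_ifs with h1 h2
  · positivity
  · exact_mod_cast two_le_dist_of_not_adj hG h1 fun h => h2.2.2 (hf u v h2.1 h2.2.1 h)
  · exact_mod_cast one_le_dist_of_ne hG h1

/-- As a matrix, `classDist` is `J - I`, plus the all-ones block outside `S`, minus the all-ones
block of each class. -/
theorem sum_classDist_mul {V α : Type*} [Fintype V] [DecidableEq V] [Fintype α] [DecidableEq α]
    (S : Finset V) (f : V → α) (x : V → ℝ) :
    ∑ u, ∑ v, classDist S f u v * (x u * x v) =
      (∑ u, x u) ^ 2 - ∑ u, x u ^ 2 + (∑ u with u ∉ S, x u) ^ 2 -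
        ∑ i, (∑ u with u ∉ S ∧ f u = i, x u) ^ 2 := by
  let z : V → ℝ := fun u => if u ∉ S then x u else 0
  have hY : ∑ u with u ∉ S, x u = ∑ u, z u := sum_filter _ _
  have hYi : ∀ i, ∑ u with u ∉ S ∧ f u = i, x u = ∑ u, if f u = i then z u else 0 := by
    intro i
    rw [sum_filter]
    refine sum_congr rfl fun u _ => ?_
    simp only [z]
    split_ifs <;> simp_all
  have hYY : ∑ i, (∑ u with u ∉ S ∧ f u = i, x u) ^ 2 =
      ∑ u, ∑ v, if f u = f v then z u * z v else 0 := by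
    simp only [hYi, sq, sum_mul_sum]
    rw [sum_comm]
    refine sum_congr rfl fun u _ => ?_
    rw [sum_comm]
    refine sum_congr rfl fun v _ => ?_
    rw [sum_eq_single (f u)]
    · by_cases h : f u = f v
      · simp [h]
      · simp [h, Ne.symm h]
    · intro i _ hi
      simp [Ne.symm hi]
    · simp
  have hxx : ∑ u, x u ^ 2 = ∑ u, ∑ v, if u = v then x u * x v else 0 := by
    refine sum_congr rfl fun u _ => ?_
    simp [sq]
  rw [hY, hYY, hxx, sq, sq, sum_mul_sum, sum_mul_sum]
  simp only [← sum_sub_distrib, ← sum_add_distrib]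
  refine sum_congr rfl fun u _ => sum_congr rfl fun v _ => ?_
  simp only [classDist, z]
  by_cases h1 : u = v
  · subst h1; simp
  · by_cases hu : u ∈ S <;> by_cases hv : v ∈ S <;> by_cases h : f u = f v <;>
      simp [h1, hu, hv, h]
    ring

/-- The part of the vertices outside `S` with `f`-value `i`. -/
def part {V α : Type*} [Fintype V] [DecidableEq V] [DecidableEq α] (S : Finset V) (f : V → α)
    (i : α) : Finset V :=
  {u | u ∉ S ∧ f u = i}

theorem mem_part {V α : Type*} [Fintype V] [DecidableEq V] [DecidableEq α] {S : Finset V}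
    {f : V → α} {i : α} {u : V} : u ∈ part S f i ↔ u ∉ S ∧ f u = i := by
  simp [part]

theorem sum_part {V α : Type*} [Fintype V] [DecidableEq V] [Fintype α] [DecidableEq α]
    (S : Finset V) (f : V → α) (x : V → ℝ) :
    ∑ u with u ∉ S, x u = ∑ i, ∑ u ∈ part S f i, x u := by
  rw [← sum_fiberwise _ f]
  refine sum_congr rfl fun i _ => ?_
  rw [part, filter_filter]

theorem card_add_sum_card_part {V α : Type*} [Fintype V] [DecidableEq V] [Fintype α]
    [DecidableEq α] (S : Finset V) (f : V → α) :
    S.card + ∑ i, (part S f i).card = Fintype.card V := by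
  have h : ∑ i, (part S f i).card = #{u : V | u ∉ S} := by
    rw [card_eq_sum_card_fiberwise (f := f) (t := univ) (fun _ _ => by simp)]
    refine sum_congr rfl fun i _ => ?_
    rw [part, filter_filter]
  have h2 : #{u : V | u ∉ S} = #(Sᶜ) := by
    congr 1; ext u; simp
  rw [h, h2, card_add_card_compl]

/-- The three-valued test vector: `a` on `S`, `c` on the sets `T i` and `b` elsewhere. -/
def testVector {V α : Type*} [DecidableEq V] (S : Finset V) (f : V → α) (T : α → Finset V)
    (a b c : ℝ) (u : V) : ℝ :=
  if u ∈ S then a else if u ∈ T (f u) then c else b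

theorem sum_testVector {V α : Type*} [Fintype V] [DecidableEq V] [DecidableEq α]
    {S : Finset V} {f : V → α} {T : α → Finset V} {i : α} (hT : T i ⊆ part S f i)
    (a b c : ℝ) :
    ∑ u ∈ part S f i, testVector S f T a b c u =
      (T i).card * c + ((part S f i).card - (T i).card) * b := by
  have h : ∀ u ∈ part S f i, testVector S f T a b c u = if u ∈ T i then c else b := by
    intro u hu
    obtain ⟨h1, h2⟩ := mem_part.mp hu
    simp [testVector, h1, h2]
  rw [sum_congr rfl h, sum_ite, sum_const, sum_const, nsmul_eq_mul, nsmul_eq_mul]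
  have h1 : (part S f i).filter (fun u => u ∈ T i) = T i := by
    ext u; simp only [mem_filter]; exact ⟨fun h => h.2, fun h => ⟨hT h, h⟩⟩
  have h2 : (part S f i).filter (fun u => u ∉ T i) = part S f i \ T i := by
    ext u; simp
  rw [h1, h2, cast_card_sdiff hT]

theorem sum_univ_eq_sum_add {V : Type*} [Fintype V] [DecidableEq V] (S : Finset V) (x : V → ℝ) :
    ∑ u, x u = ∑ u ∈ S, x u + ∑ u with u ∉ S, x u := by
  rw [← sum_filter_add_sum_filter_not univ (· ∈ S) x]
  congr 1
  refine sum_congr ?_ fun _ _ => rfl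
  ext u; simp

/-- The estimate for the class sums of the test vector: `n i` is the size of a class and `t` the
number of its vertices with weight `c`, except in the class `i₀`. -/
theorem sum_class_sq_le {α : Type*} [Fintype α] [DecidableEq α] (i₀ : α) (m : α → ℝ)
    (hm : ∀ i, 0 ≤ m i) (b c t : ℝ) (r : ℕ) (hr : Fintype.card α = r + 1) :
    ∑ i, ((if i = i₀ then 0 else t) * c + m i * b) ^ 2 ≤
      (∑ i, m i) ^ 2 * b ^ 2 + r * t ^ 2 * c ^ 2 -
        2 * (∑ i, m i - m i₀) * b * (m i₀ * b - t * c) := by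
  have hsum : ∑ i, m i = m i₀ + ∑ i ∈ univ.erase i₀, m i :=
    (add_sum_erase _ _ (mem_univ i₀)).symm
  have hcard : ((univ.erase i₀).card : ℝ) = r := by
    rw [card_erase_of_mem (mem_univ _), card_univ, hr]; simp
  -- Merging the surplus vertices of the other classes only increases the sum of squares; the last
  -- term of the bound records the further increase from moving them into class `i₀`.
  have hsq : ∑ i ∈ univ.erase i₀, m i ^ 2 ≤ (∑ i ∈ univ.erase i₀, m i) ^ 2 :=
    sum_sq_le_sq_sum_of_nonneg fun i _ => hm i
  have e : ∑ i ∈ univ.erase i₀, ((if i = i₀ then 0 else t) * c + m i * b) ^ 2 =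
      r * t ^ 2 * c ^ 2 + 2 * t * c * b * ∑ i ∈ univ.erase i₀, m i +
        b ^ 2 * ∑ i ∈ univ.erase i₀, m i ^ 2 := by
    rw [← hcard, mul_sum, mul_sum, mul_assoc, ← nsmul_eq_mul, ← sum_const, ← sum_add_distrib,
      ← sum_add_distrib]
    refine sum_congr rfl fun i hi => ?_
    rw [if_neg (ne_of_mem_erase hi)]
    ring
  rw [← add_sum_erase _ _ (mem_univ i₀), e, hsum, if_pos rfl]
  nlinarith [mul_le_mul_of_nonneg_left hsq (sq_nonneg b)]

theorem dotProduct_distMatrix_mulVec {V : Type*} [Fintype V] (G : SimpleGraph V)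
    (x : V → ℝ) :
    x ⬝ᵥ G.distMatrix.mulVec x = ∑ u, ∑ v, (G.dist u v : ℝ) * (x u * x v) := by
  simp only [dotProduct, Matrix.mulVec, distMatrix, Matrix.of_apply, mul_sum]
  refine sum_congr rfl fun u _ => sum_congr rfl fun v _ => ?_
  ring

theorem dotProduct_le_distSpectralRadius {V : Type*} [Fintype V] [DecidableEq V]
    (G : SimpleGraph V) (x : V → ℝ) :
    x ⬝ᵥ G.distMatrix.mulVec x ≤ G.distSpectralRadius * (x ⬝ᵥ x) :=
  G.distMatrix_isHermitian.dotProduct_mulVec_le_iSup_eigenvalues x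

set_option maxHeartbeats 800000 in
/-- The main estimate: a graph with a cut set `S` and `r + 1` classes of at least `t` vertices
has distance spectral radius above `M - 1` if the residual is positive; if the residual is zero
and the distance spectral radius is at most `M - 1`, then the graph is determined. -/
theorem joinResidual_bound {V α : Type*} [Fintype V] [DecidableEq V] [Fintype α] [DecidableEq α]
    {G : SimpleGraph V} (hG : G.Connected) {S : Finset V} {f : V → α}
    (hf : ∀ u v, u ∉ S → v ∉ S → G.Adj u v → f u = f v) {r t : ℕ}
    (hr : Fintype.card α = r + 1) (ht : 1 ≤ t) (hpart : ∀ i, t ≤ (part S f i).card) {i₀ : α}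
    (hmax : ∀ i, (part S f i).card ≤ (part S f i₀).card)
    (hlarge : t = 1 ∨ 2 * t ≤ (part S f i₀).card) {M : ℝ}
    (hk : 2 * ((r : ℝ) * t) ≤ Fintype.card V) (hM : (Fintype.card V : ℝ) + 1 ≤ M)
    (hrad : G.distSpectralRadius ≤ M - 1) :
    joinResidual (Fintype.card V) M S.card t (r * t) ≤ 0 ∧
      (joinResidual (Fintype.card V) M S.card t (r * t) = 0 →
        (∀ u v, (G.dist u v : ℝ) = classDist S f u v) ∧
          ∀ i, i ≠ i₀ → (part S f i).card = t) := by
  -- Each class except `i₀` reserves `t` vertices for the weight `c`; all remaining vertices outside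
  -- `S` count towards the `K_q` of the model.
  have hTex : ∀ i, ∃ T ⊆ part S f i, T.card = if i = i₀ then 0 else t := fun i =>
    exists_subset_card_eq (by split_ifs <;> simp [hpart i])
  choose T hT hTc using hTex
  obtain ⟨m, hmdef⟩ : ∃ m : α → ℝ, ∀ i, m i = (part S f i).card - (T i).card :=
    ⟨_, fun _ => rfl⟩
  have hm : ∀ i, 0 ≤ m i := fun i => by
    rw [hmdef, sub_nonneg]; exact_mod_cast card_le_card (hT i)
  have hTc' : ∀ i, ((T i).card : ℝ) = if i = i₀ then 0 else (t : ℝ) := fun i => by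
    rw [hTc i]; split_ifs <;> simp
  have hTsum : ∑ i, ((T i).card : ℝ) = r * t := by
    have hcard : ((univ.erase i₀).card : ℝ) = r := by
      rw [card_erase_of_mem (mem_univ _), card_univ, hr]; simp
    rw [← add_sum_erase _ _ (mem_univ i₀), hTc', if_pos rfl, zero_add, ← hcard, ← nsmul_eq_mul,
      ← sum_const]
    refine sum_congr rfl fun i hi => ?_
    rw [hTc', if_neg (ne_of_mem_erase hi)]
  set n : ℝ := (Fintype.card V : ℝ) with hn
  set s : ℝ := (S.card : ℝ) with hs
  set k : ℝ := r * t with hkdef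
  set q : ℝ := ∑ i, m i with hq
  have ht1 : (1 : ℝ) ≤ t := by exact_mod_cast ht
  have hs0 : 0 ≤ s := by positivity
  have hk0 : 0 ≤ k := by positivity
  have hq0 : 0 ≤ q := sum_nonneg fun i _ => hm i
  have hnsum : n = s + k + q := by
    have h := card_add_sum_card_part S f
    have h' : s + ∑ i, ((part S f i).card : ℝ) = n := by
      rw [hs, hn, ← h]; push_cast; rfl
    have : q = ∑ i, ((part S f i).card : ℝ) - k := by
      rw [hq, sum_congr rfl fun i _ => hmdef i, sum_sub_distrib, hTsum]
    linarith
  have hM0 : 0 < M := by linarith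
  -- Write `X` and `Y` for the sums over all vertices and over those outside `S`. The eigenvector
  -- equations of the model for `D + I` are `X = M a` and `X + Y = (M + q) b = (M + t) c`. The
  -- weights satisfy them with `M a` in place of `X`; the defect `X - M a` is the residual.
  obtain ⟨a, hadef⟩ : ∃ a : ℝ, a = M * (M + t) - k * (M + q) := ⟨_, rfl⟩
  obtain ⟨b, hbdef⟩ : ∃ b : ℝ, b = M * (M + t) := ⟨_, rfl⟩
  obtain ⟨c, hcdef⟩ : ∃ c : ℝ, c = M * (M + q) := ⟨_, rfl⟩
  have ha : 0 < a := by
    have h := joinWeight_pos (t := (t : ℝ)) hs0 (by linarith) hk0 hk hM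
    have e : n - s - k = q := by linarith
    rwa [e, ← hadef] at h
  have hb : 0 < b := by rw [hbdef]; positivity
  have hc : 0 < c := by rw [hcdef]; positivity
  obtain ⟨x, hxdef⟩ : ∃ x, x = testVector S f T a b c := ⟨_, rfl⟩
  have hx : ∀ u, 0 < x u := fun u => by
    simp only [hxdef, testVector]; split_ifs <;> assumption
  have hYi : ∀ i, ∑ u ∈ part S f i, x u = (T i).card * c + m i * b := fun i => by
    rw [hxdef, sum_testVector (hT i) a b c, hmdef]
  have hYi2 : ∀ i, ∑ u ∈ part S f i, x u ^ 2 = (T i).card * c ^ 2 + m i * b ^ 2 := fun i => by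
    rw [hmdef, ← sum_testVector (hT i) (a ^ 2) (b ^ 2) (c ^ 2)]
    refine sum_congr rfl fun u _ => ?_
    simp only [hxdef, testVector]; split_ifs <;> rfl
  have hY : ∑ u with u ∉ S, x u = k * c + q * b := by
    rw [sum_part S f, sum_congr rfl fun i _ => hYi i, sum_add_distrib, ← sum_mul, ← sum_mul,
      hTsum]
  have hY2 : ∑ u with u ∉ S, x u ^ 2 = k * c ^ 2 + q * b ^ 2 := by
    rw [sum_part S f, sum_congr rfl fun i _ => hYi2 i, sum_add_distrib, ← sum_mul, ← sum_mul,
      hTsum]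
  have hX : ∑ u, x u = s * a + (k * c + q * b) := by
    rw [sum_univ_eq_sum_add S, hY]
    congr 1
    rw [sum_congr rfl (g := fun _ => a), sum_const, nsmul_eq_mul]
    intro u hu
    simp [hxdef, testVector, hu]
  have hX2 : ∑ u, x u ^ 2 = s * a ^ 2 + (k * c ^ 2 + q * b ^ 2) := by
    rw [sum_univ_eq_sum_add S, hY2]
    congr 1
    rw [sum_congr rfl (g := fun _ => a ^ 2), sum_const, nsmul_eq_mul]
    intro u hu
    simp [hxdef, testVector, hu]
  have hm0 : m i₀ = (part S f i₀).card := by simp [hmdef, hTc]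
  have hYsq : ∑ i, (∑ u with u ∉ S ∧ f u = i, x u) ^ 2 ≤
      q ^ 2 * b ^ 2 + r * (t : ℝ) ^ 2 * c ^ 2 - 2 * (q - m i₀) * b * (m i₀ * b - t * c) := by
    have h := sum_class_sq_le i₀ m hm b c t r hr
    rw [← hq] at h
    refine le_trans (le_of_eq (sum_congr rfl fun i _ => ?_)) h
    rw [← hTc' i, ← hYi i, part]
  set extra := ∑ u, ∑ v, ((G.dist u v : ℝ) - classDist S f u v) * (x u * x v) with hextra
  have hterm : ∀ u v, 0 ≤ ((G.dist u v : ℝ) - classDist S f u v) * (x u * x v) := fun u v =>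
    mul_nonneg (sub_nonneg.mpr (classDist_le_dist hG hf u v)) (mul_pos (hx u) (hx v)).le
  have hextra0 : 0 ≤ extra := sum_nonneg fun u _ => sum_nonneg fun v _ => hterm u v
  have hD : x ⬝ᵥ G.distMatrix.mulVec x =
      extra + ∑ u, ∑ v, classDist S f u v * (x u * x v) := by
    rw [dotProduct_distMatrix_mulVec, hextra, ← sum_add_distrib]
    refine sum_congr rfl fun u _ => ?_
    rw [← sum_add_distrib]
    refine sum_congr rfl fun v _ => ?_
    ring
  have hxx : x ⬝ᵥ x = s * a ^ 2 + (k * c ^ 2 + q * b ^ 2) := by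
    rw [← hX2]; simp [dotProduct, sq]
  have hray : x ⬝ᵥ G.distMatrix.mulVec x ≤ (M - 1) * (x ⬝ᵥ x) :=
    (G.dotProduct_le_distSpectralRadius x).trans (mul_le_mul_of_nonneg_right hrad (by
      rw [hxx]; positivity))
  rw [hD, hxx, sum_classDist_mul, hX, hX2, hY] at hray
  -- On the model graph `(D + I)x - Mx` is constantly the residual; this is its pairing with `x`.
  have hid : (s * a + (k * c + q * b)) ^ 2 - M * (s * a ^ 2 + (k * c ^ 2 + q * b ^ 2)) +
      (k * c + q * b) ^ 2 - q ^ 2 * b ^ 2 - r * (t : ℝ) ^ 2 * c ^ 2 =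
      joinResidual n M s t k * (s * a + (k * c + q * b)) := by
    have e : (r : ℝ) * (t : ℝ) ^ 2 = k * t := by rw [hkdef]; ring
    rw [e, hnsum, hadef, hbdef, hcdef]
    simp only [joinResidual]
    ring
  have hXpos : 0 < s * a + (k * c + q * b) := by
    rw [← hX]
    have : Nonempty V := hG.nonempty
    exact sum_pos (fun u _ => hx u) univ_nonempty
  have hqm : q - m i₀ = ∑ i ∈ univ.erase i₀, m i := by
    rw [hq, ← add_sum_erase _ _ (mem_univ i₀)]; ring
  have hqm0 : 0 ≤ q - m i₀ := hqm ▸ sum_nonneg fun i _ => hm i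
  have hcb : c < 2 * b := by
    have : M + q < 2 * (M + t) := by linarith
    calc c = M * (M + q) := hcdef
      _ < M * (2 * (M + t)) := mul_lt_mul_of_pos_left this hM0
      _ = 2 * b := by rw [hbdef]; ring
  -- Moving the surplus into `i₀` gains strictly when class `i₀` has at least `2t` vertices, because
  -- `c < 2b`. Otherwise `t = 1` and all classes are singletons, so there is no surplus.
  have hgain : 0 ≤ 2 * (q - m i₀) * b * (m i₀ * b - t * c) ∧
      (2 * (q - m i₀) * b * (m i₀ * b - t * c) ≤ 0 → q - m i₀ = 0) := by
    by_cases h2 : 2 * t ≤ (part S f i₀).card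
    · have h2' : 2 * (t : ℝ) ≤ m i₀ := by rw [hm0]; exact_mod_cast h2
      have h3 : 0 < m i₀ * b - t * c := by
        have h4 := mul_le_mul_of_nonneg_right h2' hb.le
        have h5 : t * c < t * (2 * b) := mul_lt_mul_of_pos_left hcb (by linarith)
        linarith
      refine ⟨by positivity, fun h => ?_⟩
      by_contra hne
      have : 0 < q - m i₀ := lt_of_le_of_ne hqm0 (Ne.symm hne)
      have : 0 < 2 * (q - m i₀) * b * (m i₀ * b - t * c) := by positivity
      linarith
    · have h1 : t = 1 := hlarge.resolve_right h2
      have hz : q - m i₀ = 0 := by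
        rw [hqm]
        refine sum_eq_zero fun i hi => ?_
        have h4 := hmax i
        have h5 := hpart i
        have h6 : (part S f i).card = 1 := by omega
        simp [hmdef, hTc, if_neg (ne_of_mem_erase hi), h1, h6]
      rw [hz]
      simp
  have hmain : joinResidual n M s t k * (s * a + (k * c + q * b)) + extra +
      2 * (q - m i₀) * b * (m i₀ * b - t * c) ≤ 0 := by
    rw [← hid]
    linarith
  constructor
  · by_contra hpos
    have := mul_pos (not_le.mp hpos) hXpos
    linarith [hgain.1]
  · intro hzero
    rw [hzero, zero_mul, zero_add] at hmain
    have he : extra = 0 := by linarith [hgain.1]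
    have hqz := hgain.2 (by linarith)
    constructor
    · intro u v
      have h1 := (sum_eq_zero_iff_of_nonneg fun u _ => sum_nonneg fun v _ => hterm u v).mp he u
        (mem_univ u)
      have h2 := (sum_eq_zero_iff_of_nonneg fun v _ => hterm u v).mp h1 v (mem_univ v)
      have h3 := (mul_eq_zero.mp h2).resolve_right (mul_pos (hx u) (hx v)).ne'
      linarith
    · intro i hi
      rw [hqm] at hqz
      have h1 := (sum_eq_zero_iff_of_nonneg fun i _ => hm i).mp hqz i
        (mem_erase.mpr ⟨hi, mem_univ i⟩)
      have h2 : ((part S f i).card : ℝ) = t := by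
        have h3 := hTc' i
        rw [if_neg hi] at h3
        have : ((part S f i).card : ℝ) - (T i).card = 0 := by rw [← hmdef, h1]
        linarith
      exact_mod_cast h2

end SimpleGraph

/-! ### The extremal graph -/

namespace SimpleGraph

open Finset

theorem extremalGraph_adj_inl_inl {n δ : ℕ} (i j : Fin δ) :
    (extremalGraph n δ).Adj (.inl i) (.inl j) ↔ i ≠ j := by
  simp [extremalGraph, joinGraph]

theorem extremalGraph_adj_inl_inr {n δ : ℕ} (i : Fin δ) (w) :
    (extremalGraph n δ).Adj (.inl i) (.inr w) := by
  simp [extremalGraph, joinGraph]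

theorem extremalGraph_adj_inr_inl {n δ : ℕ} (i : Fin δ) (w) :
    (extremalGraph n δ).Adj (.inr w) (.inl i) := by
  simp [extremalGraph, joinGraph]

theorem extremalGraph_adj_inr_inl_inl {n δ : ℕ} (i j) :
    (extremalGraph n δ).Adj (.inr (.inl i)) (.inr (.inl j)) ↔ i ≠ j := by
  simp [extremalGraph, joinGraph]

theorem extremalGraph_not_adj_inr_inr_left {n δ : ℕ} (i w) :
    ¬ (extremalGraph n δ).Adj (.inr (.inr i)) (.inr w) := by
  cases w <;> simp [extremalGraph, joinGraph]

theorem extremalGraph_not_adj_inr_inr_right {n δ : ℕ} (i w) :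
    ¬ (extremalGraph n δ).Adj (.inr w) (.inr (.inr i)) := fun h =>
  extremalGraph_not_adj_inr_inr_left i w h.symm

theorem dist_le_one_of_adj_or_eq {V : Type*} {G : SimpleGraph V} [DecidableEq V] {u v : V}
    (h : u ≠ v → G.Adj u v) : (G.dist u v : ℝ) ≤ if u = v then 0 else 1 := by
  split_ifs with huv
  · simp [huv]
  · rw [dist_eq_one_iff_adj.mpr (h huv), Nat.cast_one]

theorem dist_extremalGraph_inr_le_two {n δ : ℕ} (hδ : 0 < δ) (u v) :
    ((extremalGraph n δ).dist (.inr u) (.inr v) : ℝ) ≤ 2 := by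
  have h := (extremalGraph n δ).dist_le (Walk.cons (extremalGraph_adj_inr_inl ⟨0, hδ⟩ u)
    (Walk.cons (extremalGraph_adj_inl_inr ⟨0, hδ⟩ v) Walk.nil))
  simp only [Walk.length_cons, Walk.length_nil] at h
  exact_mod_cast h

theorem sum_le_of_forall_le_ite {m : ℕ} (g : Fin m → ℝ) (i : Fin m) (e y : ℝ) (hy : 0 ≤ y)
    (hg : ∀ j, g j ≤ if i = j then 0 else e) : ∑ j, g j * y ≤ (m - 1) * e * y := by
  calc ∑ j, g j * y ≤ ∑ j, (if i = j then 0 else e) * y :=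
        sum_le_sum fun j _ => mul_le_mul_of_nonneg_right (hg j) hy
    _ = (m - 1) * e * y := by
        have h : ∀ j, (if i = j then 0 else e) * y = e * y - if i = j then e * y else 0 := by
          intro j; split_ifs <;> ring
        simp only [h, sum_sub_distrib]
        simp
        ring

theorem sum_le_of_forall_le {m : ℕ} (g : Fin m → ℝ) (e y : ℝ) (hy : 0 ≤ y)
    (hg : ∀ j, g j ≤ e) : ∑ j, g j * y ≤ m * e * y := by
  calc ∑ j, g j * y ≤ ∑ _j : Fin m, e * y :=
        sum_le_sum fun j _ => mul_le_mul_of_nonneg_right (hg j) hy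
    _ = m * e * y := by simp; ring

/-- The weights with `t = 1`, `k = δ + 1` have zero residual by `hP`, so they form a positive
subinvariant vector. Only this upper bound is needed, hence only upper bounds on distances. -/
theorem distSpectralRadius_extremalGraph_le {n δ : ℕ} (hδ : 2 ≤ δ) (hn : 9 * δ ≤ n) {M : ℝ}
    (hM : (n : ℝ) + 1 ≤ M)
    (hP : (M + δ + 1 - n) * (M + 1) * M = (δ + 1) * (M + n - 1 - 2 * δ) * (2 * M - δ)) :
    (extremalGraph n δ).distSpectralRadius ≤ M - 1 := by
  have hδ1 : 0 < δ := by omega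
  have hδr : (2 : ℝ) ≤ δ := by exact_mod_cast hδ
  have hnr : 9 * (δ : ℝ) ≤ n := by exact_mod_cast hn
  have hM0 : 0 < M := by linarith
  have hp : ((n - 2 * δ - 1 : ℕ) : ℝ) = n - 2 * δ - 1 := by
    rw [Nat.cast_sub (by omega), Nat.cast_sub (by omega)]; push_cast; ring
  set q : ℝ := (n : ℝ) - 2 * δ - 1 with hq
  have hq0 : 0 < q := by linarith
  let a := M * (M + 1) - (δ + 1) * (M + q)
  let b := M * (M + 1)
  let c := M * (M + q)
  have ha : 0 < a := by
    have h := joinWeight_pos (n := (n : ℝ)) (M := M) (s := δ) (t := 1) (k := (δ : ℝ) + 1)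
      (by linarith) one_pos.le (by linarith) (by linarith) hM
    have e : (n : ℝ) - δ - (δ + 1) = q := by rw [hq]; ring
    rw [e] at h
    exact h
  have hb : 0 < b := by positivity
  have hc : 0 < c := by positivity
  have hres : δ * a + q * b + (δ + 1) * c = M * a := by
    simp only [a, b, c, hq]
    linear_combination -hP
  have hba : M * (b - a) = (δ + 1) * c := by simp only [a, b, c]; ring
  have hcb : (M + 1) * c = (M + q) * b := by simp only [b, c]; ring
  rw [distSpectralRadius]
  have : Nonempty (Fin δ) := ⟨⟨0, hδ1⟩⟩
  refine ciSup_le fun i => ?_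
  refine (extremalGraph n δ).distMatrix_isHermitian.eigenvalues_le_of_mulVec_le
    (fun u v => ?_) (x := Sum.elim (fun _ => a) (Sum.elim (fun _ => b) fun _ => c)) ?_ ?_ i
  · simp [distMatrix]
  · rintro (u | u | u) <;> assumption
  · intro u
    simp only [Matrix.mulVec, dotProduct, distMatrix, Matrix.of_apply, Fintype.sum_sum_type,
      Sum.elim_inl, Sum.elim_inr]
    rcases u with i | i | i
    · have h1 := sum_le_of_forall_le_ite (fun j => ((extremalGraph n δ).dist (.inl i) (.inl j) : ℝ))
        i 1 a ha.le fun j => by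
          simpa using dist_le_one_of_adj_or_eq (G := extremalGraph n δ) (u := .inl i) (v := .inl j)
            fun h => (extremalGraph_adj_inl_inl i j).mpr fun e => h (by rw [e])
      have h2 := sum_le_of_forall_le
        (fun j => ((extremalGraph n δ).dist (.inl i) (.inr (.inl j)) : ℝ)) 1 b hb.le fun j => by
          rw [dist_eq_one_iff_adj.mpr (extremalGraph_adj_inl_inr i _), Nat.cast_one]
      have h3 := sum_le_of_forall_le
        (fun j => ((extremalGraph n δ).dist (.inl i) (.inr (.inr j)) : ℝ)) 1 c hc.le fun j => by
          rw [dist_eq_one_iff_adj.mpr (extremalGraph_adj_inl_inr i _), Nat.cast_one]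
      rw [hp] at h2
      push_cast at h3
      simp only [Sum.elim_inl]
      linarith
    · have h1 := sum_le_of_forall_le
        (fun j => ((extremalGraph n δ).dist (.inr (.inl i)) (.inl j) : ℝ)) 1 a ha.le fun j => by
          rw [dist_eq_one_iff_adj.mpr (extremalGraph_adj_inr_inl j _), Nat.cast_one]
      have h2 := sum_le_of_forall_le_ite
        (fun j => ((extremalGraph n δ).dist (.inr (.inl i)) (.inr (.inl j)) : ℝ))
        i 1 b hb.le fun j => by
          simpa using dist_le_one_of_adj_or_eq (G := extremalGraph n δ) (u := .inr (.inl i))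
            (v := .inr (.inl j))
            fun h => (extremalGraph_adj_inr_inl_inl i j).mpr fun e => h (by rw [e])
      have h3 := sum_le_of_forall_le
        (fun j => ((extremalGraph n δ).dist (.inr (.inl i)) (.inr (.inr j)) : ℝ)) 2 c hc.le
        fun j => dist_extremalGraph_inr_le_two hδ1 _ _
      rw [hp] at h2
      push_cast at h3
      simp only [Sum.elim_inl, Sum.elim_inr]
      linarith
    · have h1 := sum_le_of_forall_le
        (fun j => ((extremalGraph n δ).dist (.inr (.inr i)) (.inl j) : ℝ)) 1 a ha.le fun j => by
          rw [dist_eq_one_iff_adj.mpr (extremalGraph_adj_inr_inl j _), Nat.cast_one]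
      have h2 := sum_le_of_forall_le
        (fun j => ((extremalGraph n δ).dist (.inr (.inr i)) (.inr (.inl j)) : ℝ)) 2 b hb.le
        fun j => dist_extremalGraph_inr_le_two hδ1 _ _
      have h3 := sum_le_of_forall_le_ite
        (fun j => ((extremalGraph n δ).dist (.inr (.inr i)) (.inr (.inr j)) : ℝ))
        i 2 c hc.le fun j => by
          split_ifs with h
          · simp [h]
          · exact dist_extremalGraph_inr_le_two hδ1 _ _
      rw [hp] at h2
      push_cast at h3
      simp only [Sum.elim_inr]
      linarith

theorem nonempty_iso_extremalGraph {V : Type*} [Fintype V] [DecidableEq V] {G : SimpleGraph V}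
    {n δ : ℕ} (hn : Fintype.card V = n) (hnδ : 2 * δ + 1 ≤ n) {S P : Finset V}
    (hdisj : Disjoint S P) (hS : S.card = δ) (hP : P.card = n - 2 * δ - 1)
    (hadj : ∀ u v, G.Adj u v ↔ u ≠ v ∧ (u ∈ S ∨ v ∈ S ∨ (u ∈ P ∧ v ∈ P))) :
    Nonempty (G ≃g extremalGraph n δ) := by
  have hS' : Nonempty (S ≃ Fin δ) := ⟨S.equivFinOfCardEq hS⟩
  have hP' : Nonempty (P ≃ Fin (n - 2 * δ - 1)) := ⟨P.equivFinOfCardEq hP⟩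
  have hR : ((S ∪ P)ᶜ).card = δ + 1 := by
    rw [card_compl, card_union_of_disjoint hdisj, hS, hP, hn]; omega
  obtain ⟨eS⟩ := hS'
  obtain ⟨eP⟩ := hP'
  let eR := ((S ∪ P)ᶜ).equivFinOfCardEq hR
  let g : Fin δ ⊕ (Fin (n - 2 * δ - 1) ⊕ Fin (δ + 1)) → V :=
    Sum.elim (fun i => eS.symm i) (Sum.elim (fun i => eP.symm i) fun i => eR.symm i)
  have gS : ∀ i, g (.inl i) ∈ S := fun i => (eS.symm i).2
  have gP : ∀ i, g (.inr (.inl i)) ∈ P := fun i => (eP.symm i).2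
  have gR : ∀ i, g (.inr (.inr i)) ∉ S ∧ g (.inr (.inr i)) ∉ P := fun i => by
    simpa [g] using (eR.symm i).2
  have gPS : ∀ i, g (.inr (.inl i)) ∉ S := fun i h => Finset.disjoint_left.mp hdisj h (gP i)
  have ginj : Function.Injective g := by
    rintro (i | i | i) (j | j | j) h
    · simpa [g, Subtype.ext_iff] using h
    · exact absurd (h ▸ gS i) (gPS j)
    · exact absurd (h ▸ gS i) (gR j).1
    · exact absurd (h ▸ gS j) (gPS i)
    · simpa [g, Subtype.ext_iff] using h
    · exact absurd (h ▸ gP i) (gR j).2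
    · exact absurd (h ▸ gS j) (gR i).1
    · exact absurd (h ▸ gP j) (gR i).2
    · simpa [g, Subtype.ext_iff] using h
  have gbij : Function.Bijective g := by
    rw [Fintype.bijective_iff_injective_and_card]
    refine ⟨ginj, ?_⟩
    simp [hn]; omega
  refine ⟨(RelIso.symm ⟨Equiv.ofBijective g gbij, ?_⟩)⟩
  intro x y
  simp only [Equiv.ofBijective_apply]
  rw [hadj, ginj.ne_iff]
  rcases x with i | i | i <;> rcases y with j | j | j
  · simp [gS, extremalGraph_adj_inl_inl]
  · simp [gS, extremalGraph_adj_inl_inr]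
  · simp [gS, extremalGraph_adj_inl_inr]
  · simp [gS, extremalGraph_adj_inr_inl]
  · simp [gP, extremalGraph_adj_inr_inl_inl]
  · simp [gPS, gR, extremalGraph_not_adj_inr_inr_right]
  · simp [gS, extremalGraph_adj_inr_inl]
  · simp [gPS, gR, extremalGraph_not_adj_inr_inr_left]
  · simp [gR, extremalGraph_not_adj_inr_inr_left]

/-- Deleting the `δ` dominating vertices leaves `δ + 1` isolated vertices and a clique, nonempty
because `2δ + 2 ≤ n`: in total `δ + 2` components. -/
theorem not_isEnomotoTough_of_iso_extremalGraph {V : Type*} [Fintype V] {G : SimpleGraph V}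
    {n δ : ℕ} (hnδ : 2 * δ + 2 ≤ n) (φ : G ≃g extremalGraph n δ) : ¬ G.IsEnomotoTough 1 := by
  rw [not_isEnomotoTough_one_iff]
  let S : Finset V := univ.map ⟨fun i : Fin δ => φ.symm (.inl i), fun i j h => by simpa using h⟩
  have hS : ∀ v, v ∉ S ↔ ∃ w, φ v = .inr w := by
    intro v
    obtain ⟨w, rfl⟩ := φ.symm.surjective v
    rcases w with w | w
    · simpa [S] using ⟨w, rfl⟩
    · simp only [S, mem_map, mem_univ, true_and, not_exists, RelIso.apply_symm_apply,
        Sum.inr.injEq, exists_eq', iff_true]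
      intro i h
      simpa using φ.symm.injective h
  refine ⟨S, ?_⟩
  -- `none` labels the remaining clique; its value on the deleted vertices is never used.
  let h : Fin δ ⊕ (Fin (n - 2 * δ - 1) ⊕ Fin (δ + 1)) → Option (Fin (δ + 1)) :=
    Sum.elim (fun _ => none) (Sum.elim (fun _ => none) some)
  have key := card_le_componentsAfterDeleting G (S : Set V) (fun v => h (φ v)) ?_ ?_
  · rw [card_map, card_univ, Fintype.card_fin]
    rwa [Fintype.card_option, Fintype.card_fin] at key
  · intro u v hu hv huv
    obtain ⟨x, hx⟩ := (hS u).mp (by simpa using hu)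
    obtain ⟨y, hy⟩ := (hS v).mp (by simpa using hv)
    rw [← φ.map_adj_iff, hx, hy] at huv
    simp only [hx, hy]
    rcases x with x | x
    · rcases y with y | y
      · rfl
      · exact absurd huv (extremalGraph_not_adj_inr_inr_right _ _)
    · exact absurd huv (extremalGraph_not_adj_inr_inr_left _ _)
  · rintro (_ | i)
    · have hv : φ (φ.symm (.inr (.inl ⟨0, by omega⟩))) = .inr (.inl ⟨0, by omega⟩) :=
        φ.apply_symm_apply _
      exact ⟨φ.symm (.inr (.inl ⟨0, by omega⟩)),
        by simpa only [mem_coe] using (hS _).mpr ⟨_, hv⟩, by simp only [hv]; rfl⟩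
    · have hv : φ (φ.symm (.inr (.inr i))) = .inr (.inr i) := φ.apply_symm_apply _
      exact ⟨φ.symm (.inr (.inr i)),
        by simpa only [mem_coe] using (hS _).mpr ⟨_, hv⟩, by simp only [hv]; rfl⟩

end SimpleGraph

/-! ### Case analysis on the size of the cut set -/

namespace SimpleGraph

open Finset

theorem eq_of_forall_adj {V α : Type*} {G : SimpleGraph V} (hG : G.Connected) {f : V → α}
    (hf : ∀ u v, G.Adj u v → f u = f v) (u v : V) : f u = f v := by
  obtain ⟨p⟩ := hG u v
  induction p with
  | nil => rfl
  | cons h _ ih => exact (hf _ _ h).trans ih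

/-- The closed neighbourhood of `v` lies in `S` together with the class of `v`. -/
theorem minDegree_lt_card_add_card_part {V α : Type*} [Fintype V] [DecidableEq V]
    [DecidableEq α] {G : SimpleGraph V} [DecidableRel G.Adj] {S : Finset V} {f : V → α}
    (hf : ∀ u v, u ∉ S → v ∉ S → G.Adj u v → f u = f v) {v : V} (hv : v ∉ S) :
    G.minDegree + 1 ≤ S.card + (part S f (f v)).card := by
  have h1 : insert v (G.neighborFinset v) ⊆ S ∪ part S f (f v) := by
    intro w hw
    rw [mem_insert, mem_neighborFinset] at hw
    rw [mem_union, mem_part]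
    by_cases hwS : w ∈ S
    · exact Or.inl hwS
    · rcases hw with rfl | hw
      · exact Or.inr ⟨hv, rfl⟩
      · exact Or.inr ⟨hwS, (hf v w hv hwS hw).symm⟩
  have h2 := (card_le_card h1).trans (card_union_le _ _)
  rw [card_insert_of_notMem (by simp), card_neighborFinset_eq_degree] at h2
  exact (Nat.add_le_add_right (G.minDegree_le_degree v) 1).trans h2

theorem isEnomotoTough_or_iso {V : Type*} [Fintype V] [DecidableEq V] {G : SimpleGraph V}
    [DecidableRel G.Adj] {n δ : ℕ} (hG : G.Connected) (hn : Fintype.card V = n)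
    (hδ : G.minDegree = δ) (hδ2 : 2 ≤ δ) (h9 : 9 * δ ≤ n) (hsq : δ ^ 2 + 6 * δ + 6 ≤ 2 * n)
    (hspec : G.distSpectralRadius ≤ (extremalGraph n δ).distSpectralRadius) :
    G.IsEnomotoTough 1 ∨ Nonempty (G ≃g extremalGraph n δ) := by
  rw [or_iff_not_imp_left, not_isEnomotoTough_one_iff]
  rintro ⟨S, hSc⟩
  have hδr : (2 : ℝ) ≤ δ := by exact_mod_cast hδ2
  have h9r : 9 * (δ : ℝ) ≤ n := by exact_mod_cast h9
  obtain ⟨M, hM, hP⟩ := exists_extremal_root n δ hδr h9r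
  have hM1 : (n : ℝ) + 1 ≤ M := by linarith
  have hrad := hspec.trans (distSpectralRadius_extremalGraph_le hδ2 h9 hM1 hP)
  obtain ⟨f, hf, hsurj⟩ := exists_classes_of_le_componentsAfterDeleting G (S : Set V)
    (S.card + 1) hSc
  simp only [mem_coe] at hf hsurj
  obtain ⟨i₀, -, hmax⟩ := exists_max_image univ (fun i => (part S f i).card) univ_nonempty
  replace hmax : ∀ i, (part S f i).card ≤ (part S f i₀).card := fun i => hmax i (mem_univ i)
  have hsum : S.card + ∑ i, (part S f i).card = n := hn ▸ card_add_sum_card_part S f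
  have hpart1 : ∀ i, 1 ≤ (part S f i).card := fun i => by
    obtain ⟨v, hv, hvi⟩ := hsurj i
    exact card_pos.mpr ⟨v, mem_part.mpr ⟨hv, hvi⟩⟩
  rcases lt_or_ge S.card δ with hlt | hge
  · exfalso
    have hS1 : 1 ≤ S.card := by
      by_contra h0
      have hS0 : S = ∅ := card_eq_zero.mp (by omega)
      subst hS0
      obtain ⟨u, -, hu⟩ := hsurj 0
      obtain ⟨v, -, hv⟩ := hsurj 1
      have huv := eq_of_forall_adj hG (fun u v h => hf u v (by simp) (by simp) h) u v
      rw [hu, hv] at huv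
      exact absurd (congrArg Fin.val huv) (by simp)
    -- The class size forced by the minimum degree; `t ≥ 2` since `S.card < δ`.
    obtain ⟨t, ht⟩ : ∃ t, δ + 1 = S.card + t := ⟨δ + 1 - S.card, by omega⟩
    have hpart : ∀ i, t ≤ (part S f i).card := fun i => by
      obtain ⟨v, hv, rfl⟩ := hsurj i
      have := minDegree_lt_card_add_card_part hf hv
      omega
    -- AM-GM for two factors with sum `δ + 3`; this is where the quadratic lower bound on `n`
    -- enters.
    have hprod : 2 * ((S.card + 2) * t) ≤ n + 1 := by
      have h4 : 4 * ((S.card + 2) * t) ≤ (δ + 3) ^ 2 := by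
        have e : δ + 3 = S.card + 2 + t := by omega
        rw [e]
        nlinarith [four_mul_le_sq_add (S.card + 2) t]
      have h5 : (δ + 3) ^ 2 ≤ 2 * n + 3 := by nlinarith
      omega
    -- If all classes had at most `2t - 1` vertices, then `n ≤ s + (s+2)(2t-1) = 2(s+2)t - 2 ≤ n -
    -- 1`.
    have hn0 : 2 * t ≤ (part S f i₀).card := by
      by_contra hcon
      have h1 : ∑ i, (part S f i).card ≤ (S.card + 2) * (2 * t - 1) := by
        refine (sum_le_card_nsmul _ _ (2 * t - 1) fun i _ => ?_).trans (by simp)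
        have := hmax i
        omega
      obtain ⟨w, hw⟩ : ∃ w, t = w + 1 := ⟨t - 1, by omega⟩
      subst hw
      have e : 2 * (w + 1) - 1 = 2 * w + 1 := by omega
      rw [e] at h1
      nlinarith
    have hk : 2 * ((S.card + 1) * t) ≤ n := by nlinarith
    have hkr : 2 * (((S.card : ℝ) + 1) * t) ≤ n := by exact_mod_cast hk
    have hbound := (joinResidual_bound hG hf (r := S.card + 1) (by simp) (by omega) hpart hmax
      (Or.inr hn0) (M := M) (by rw [hn]; exact_mod_cast hk) (by rw [hn]; exact hM1) hrad).1
    rw [hn] at hbound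
    push_cast at hbound
    refine hbound.not_gt (joinResidual_pos_of_lt (d := δ) (by exact_mod_cast hS1) ?_ ?_ h9r hkr
      hM1 hP)
    · exact_mod_cast (by omega : 2 ≤ t)
    · have : (δ : ℝ) + 1 = S.card + t := by exact_mod_cast ht
      linarith
  · have hsn : 2 * S.card + 2 ≤ n := by
      have h1 : S.card + 2 ≤ ∑ i, (part S f i).card := by
        refine le_trans (by simp) (card_nsmul_le_sum _ _ 1 fun i _ => hpart1 i)
      omega
    have hsnr : 2 * (S.card : ℝ) + 2 ≤ n := by exact_mod_cast hsn
    have hbound := joinResidual_bound hG hf (r := S.card + 1) (by simp) le_rfl hpart1 hmax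
      (Or.inl rfl) (M := M) (by rw [hn]; push_cast; linarith) (by rw [hn]; exact hM1) hrad
    rw [hn] at hbound
    push_cast at hbound
    rw [mul_one] at hbound
    rcases hge.lt_or_eq with hgt | heq
    · exact absurd hbound.1 (not_le.mpr
        (joinResidual_pos_of_gt hδr (by exact_mod_cast hgt) hsnr h9r hM hP))
    -- Equality: distances are exactly those of the model and every class except `i₀` is a single
    -- vertex, so `S` and class `i₀` are the two cliques of `G*`.
    · obtain ⟨hdist, hone⟩ := hbound.2 (heq ▸ joinResidual_eq_zero hP)
      refine nonempty_iso_extremalGraph hn (by omega) (S := S) (P := part S f i₀) ?_ heq.symm ?_ ?_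
      · exact Finset.disjoint_right.mpr fun v hv => (mem_part.mp hv).1
      · have h1 : ∑ i ∈ univ.erase i₀, (part S f i).card = S.card + 1 := by
          rw [sum_congr rfl fun i hi => hone i (ne_of_mem_erase hi)]
          simp [card_erase_of_mem]
        rw [← add_sum_erase _ _ (mem_univ i₀), h1] at hsum
        omega
      · intro u v
        rw [← dist_eq_one_iff_adj, ← Nat.cast_inj (R := ℝ), hdist, Nat.cast_one, classDist]
        by_cases huv : u = v
        · simp [huv]
        by_cases hu : u ∈ S
        · simp [huv, hu]
        by_cases hv : v ∈ S
        · simp [huv, hu, hv]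
        by_cases hfuv : f u = f v
        · have hfu : f u = i₀ := by
            by_contra hne
            have h1 := card_le_one.mp (hone _ hne).le u (mem_part.mpr ⟨hu, rfl⟩) v
              (mem_part.mpr ⟨hv, hfuv.symm⟩)
            exact huv h1
          simp [huv, hu, hv, mem_part, ← hfuv, hfu]
        · have hnot : ¬ (f u = i₀ ∧ f v = i₀) := fun h => hfuv (h.1.trans h.2.symm)
          simpa [huv, hu, hv, hfuv, mem_part] using hnot

end SimpleGraph

theorem theorem1 {V : Type*} [Fintype V] [DecidableEq V] (G : SimpleGraph V)
    [DecidableRel G.Adj] (n δ : ℕ)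
    (hG : G.Connected) (hn : Fintype.card V = n) (hδ : G.minDegree = δ) (hδ2 : 2 ≤ δ)
    (hnδ : max (9 * (δ : ℝ)) ((δ : ℝ) ^ 2 / 2 + 3 * (δ : ℝ) + 3) ≤ (n : ℝ))
    (hspec : G.distSpectralRadius ≤ (SimpleGraph.extremalGraph n δ).distSpectralRadius) :
    (G.IsEnomotoTough 1 ∨ Nonempty (G ≃g SimpleGraph.extremalGraph n δ)) ∧
      (Nonempty (G ≃g SimpleGraph.extremalGraph n δ) → ¬ G.IsEnomotoTough 1) := by
  obtain ⟨h1, h2⟩ := max_le_iff.mp hnδ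
  have h9 : 9 * δ ≤ n := by exact_mod_cast h1
  have hsq : δ ^ 2 + 6 * δ + 6 ≤ 2 * n := by
    have : (δ : ℝ) ^ 2 + 6 * δ + 6 ≤ 2 * n := by linarith
    exact_mod_cast this
  exact ⟨SimpleGraph.isEnomotoTough_or_iso hG hn hδ hδ2 h9 hsq hspec, fun ⟨φ⟩ =>
    SimpleGraph.not_isEnomotoTough_of_iso_extremalGraph (by omega) φ⟩
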